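/- Let $n,m$ be positive integers and let $\mathcal D_{mn}$ be the set of invertible density matrices on $\mathbb C^n\otimes\mathbb C^m$, i.e. invertible positive semidefinite complex matrices of trace $1$. Call $\rho,\rho'\in\mathcal D_{mn}$ connected if there are invertible matrices $A\in M_n(\mathbb C)$ and $B\in M_m(\mathbb C)$ with $\rho'=(A^*\otimes B^*)\,\rho\,(A\otimes B)$. A precopula is a $\chi\in\mathcal D_{mn}$ whose partial traces satisfy $\operatorname{Tr}_1\chi=\frac1m I_m$ and $\operatorname{Tr}_2\chi=\frac1n I_n$, where $\operatorname{Tr}_1$ and $\operatorname{Tr}_2$ denote the partial traces over $\mathbb C^n$ and $\mathbb C^m$ respectively. Two precopulas $\chi,\chi'$ are equivalent if $\chi'=(U^*\otimes V^*)\,\chi\,(U\otimes V)$ for some unitary matrices $U\in M_n(\mathbb C)$ and $V\in M_m(\mathbb C)$; this is an equivalence relation, and its equivalence classes are called copulas. Theorem. For every $\rho\in\mathcal D_{mn}$ there exists a unique copula $\tilde\chi$ such that $\rho$ is connected to every representative $\chi$ of $\tilde\chi$. -/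

import Mathlib

open scoped Kronecker ComplexOrder

noncomputable section

namespace QuantumCopula

/-- Invertible density matrices: positive semidefinite, invertible, of trace one. -/
def IsState {ι : Type*} [Fintype ι] [DecidableEq ι] (ρ : Matrix ι ι ℂ) : Prop :=
  ρ.PosSemidef ∧ IsUnit ρ ∧ ρ.trace = 1

/-- The set of invertible density matrices on `ℂⁿ ⊗ ℂᵐ`; the index type of the standard product
basis is `Fin n × Fin m`. -/
abbrev State (n m : ℕ) : Type :=
  {ρ : Matrix (Fin n × Fin m) (Fin n × Fin m) ℂ // IsState ρ}

/-- Partial trace over the first tensor factor. -/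
def partialTrace₁ {n m : ℕ} (ρ : Matrix (Fin n × Fin m) (Fin n × Fin m) ℂ) :
    Matrix (Fin m) (Fin m) ℂ :=
  Matrix.of fun k l => ∑ i, ρ (i, k) (i, l)

/-- Partial trace over the second tensor factor. -/
def partialTrace₂ {n m : ℕ} (ρ : Matrix (Fin n × Fin m) (Fin n × Fin m) ℂ) :
    Matrix (Fin n) (Fin n) ℂ :=
  Matrix.of fun i j => ∑ k, ρ (i, k) (j, k)

/-- Two states are connected if `ρ' = (A* ⊗ B*) ρ (A ⊗ B)` for some invertible `A`, `B`. -/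
def Connected {n m : ℕ} (ρ ρ' : State n m) : Prop :=
  ∃ (A : Matrix (Fin n) (Fin n) ℂ) (B : Matrix (Fin m) (Fin m) ℂ), IsUnit A ∧ IsUnit B ∧
    ρ'.1 = (A.conjTranspose ⊗ₖ B.conjTranspose) * ρ.1 * (A ⊗ₖ B)

/-- A precopula is a state with uniform marginals. -/
def IsPrecopula {n m : ℕ} (ρ : State n m) : Prop :=
  partialTrace₁ ρ.1 = (1 / (m : ℂ)) • (1 : Matrix (Fin m) (Fin m) ℂ) ∧
  partialTrace₂ ρ.1 = (1 / (n : ℂ)) • (1 : Matrix (Fin n) (Fin n) ℂ)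

/-- The set of precopulas. -/
abbrev Precopula (n m : ℕ) : Type := {χ : State n m // IsPrecopula χ}

/-- Local unitary equivalence of precopulas. -/
def LocalUnitaryEquiv {n m : ℕ} (χ χ' : Precopula n m) : Prop :=
  ∃ U ∈ Matrix.unitaryGroup (Fin n) ℂ, ∃ V ∈ Matrix.unitaryGroup (Fin m) ℂ,
    χ'.1.1 = (U.conjTranspose ⊗ₖ V.conjTranspose) * χ.1.1 * (U ⊗ₖ V)

theorem localUnitaryEquiv_equivalence (n m : ℕ) :
    Equivalence (LocalUnitaryEquiv (n := n) (m := m)) where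
  refl χ := ⟨1, one_mem _, 1, one_mem _, by simp⟩
  symm := by
    rintro χ χ' ⟨U, hU, V, hV, h⟩
    refine ⟨U.conjTranspose, Unitary.star_mem hU, V.conjTranspose, Unitary.star_mem hV, ?_⟩
    have hU' : U * U.conjTranspose = 1 := Matrix.mem_unitaryGroup_iff.mp hU
    have hV' : V * V.conjTranspose = 1 := Matrix.mem_unitaryGroup_iff.mp hV
    have key : (U ⊗ₖ V) * (U.conjTranspose ⊗ₖ V.conjTranspose) = 1 := by
      rw [← Matrix.mul_kronecker_mul, hU', hV', Matrix.one_kronecker_one]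
    rw [h, Matrix.conjTranspose_conjTranspose, Matrix.conjTranspose_conjTranspose]
    calc χ.1.1 = ((U ⊗ₖ V) * (U.conjTranspose ⊗ₖ V.conjTranspose)) * χ.1.1 *
          ((U ⊗ₖ V) * (U.conjTranspose ⊗ₖ V.conjTranspose)) := by rw [key, one_mul, mul_one]
      _ = _ := by simp only [Matrix.mul_assoc]
  trans := by
    rintro χ χ' χ'' ⟨U, hU, V, hV, h⟩ ⟨U', hU', V', hV', h'⟩
    refine ⟨U * U', mul_mem hU hU', V * V', mul_mem hV hV', ?_⟩
    rw [h', h, Matrix.conjTranspose_mul, Matrix.conjTranspose_mul, Matrix.mul_kronecker_mul,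
      Matrix.mul_kronecker_mul]
    simp only [Matrix.mul_assoc]

instance precopulaSetoid (n m : ℕ) : Setoid (Precopula n m) where
  r := LocalUnitaryEquiv
  iseqv := localUnitaryEquiv_equivalence n m

/-- Copulas: precopulas modulo local unitary conjugation. -/
abbrev Copula (n m : ℕ) : Type := Quotient (precopulaSetoid n m)

end QuantumCopula

end

/-! Existence is variational: minimise `tr (A* ⊗ B*) ρ (A ⊗ B)` over `det A = det B = 1`. A minimum
exists because `ρ` is positive definite (`exists_trace_localConj_minimal`). At a minimiser `σ`,
varying one factor alone shows that each partial trace of `σ` has least trace on its orbit under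
determinant-one congruence, hence is scalar (`eq_smul_one_of_trace_minimal`). Normalising `σ` gives
a precopula.

Uniqueness: connectedness is an equivalence relation, so it suffices that connected precopulas are
locally unitarily equivalent. Singular value decompositions of `A` and `B` reduce this to positive
diagonal matrices, as local unitaries preserve uniform marginals. Those rescale the diagonal of the
state by `x i * y k` without changing its marginals; an entropy argument
(`mul_eq_one_of_marginals_eq`) forces `x i * y k = 1`. -/

namespace QuantumCopula

open Matrix

/-! ### Partial traces and one-sided multiplication -/

section PartialTrace

variable {n m : ℕ} (X : Matrix (Fin n × Fin m) (Fin n × Fin m) ℂ)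

theorem trace_partialTrace₁ : (partialTrace₁ X).trace = X.trace := by
  simp only [trace, diag_apply, partialTrace₁, of_apply, Fintype.sum_prod_type]
  exact Finset.sum_comm

theorem trace_partialTrace₂ : (partialTrace₂ X).trace = X.trace := by
  simp only [trace, diag_apply, partialTrace₂, of_apply, Fintype.sum_prod_type]

theorem partialTrace₁_smul (c : ℂ) : partialTrace₁ (c • X) = c • partialTrace₁ X := by
  ext i j
  simp [partialTrace₁, Finset.mul_sum]

theorem partialTrace₂_smul (c : ℂ) : partialTrace₂ (c • X) = c • partialTrace₂ X := by
  ext i j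
  simp [partialTrace₂, Finset.mul_sum]

theorem partialTrace₁_one_kronecker_mul (B : Matrix (Fin m) (Fin m) ℂ) :
    partialTrace₁ (((1 : Matrix (Fin n) (Fin n) ℂ) ⊗ₖ B) * X) = B * partialTrace₁ X := by
  ext k l
  simp only [partialTrace₁, of_apply, mul_apply, Fintype.sum_prod_type, kroneckerMap_apply,
    one_apply, ite_mul, one_mul, zero_mul, Finset.sum_ite_irrel, Finset.sum_const_zero,
    Finset.sum_ite_eq, Finset.mem_univ, if_true, Finset.mul_sum]
  exact Finset.sum_comm

theorem partialTrace₁_mul_one_kronecker (B : Matrix (Fin m) (Fin m) ℂ) :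
    partialTrace₁ (X * ((1 : Matrix (Fin n) (Fin n) ℂ) ⊗ₖ B)) = partialTrace₁ X * B := by
  ext k l
  simp only [partialTrace₁, of_apply, mul_apply, Fintype.sum_prod_type, kroneckerMap_apply,
    one_apply, ite_mul, mul_ite, one_mul, zero_mul, mul_zero, Finset.sum_ite_irrel,
    Finset.sum_const_zero, Finset.sum_ite_eq', Finset.mem_univ, if_true, Finset.sum_mul]
  exact Finset.sum_comm

/-- Cyclicity of the trace in the factor that is traced out. -/
theorem partialTrace₁_kronecker_one_mul_comm (A : Matrix (Fin n) (Fin n) ℂ) :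
    partialTrace₁ ((A ⊗ₖ (1 : Matrix (Fin m) (Fin m) ℂ)) * X) =
      partialTrace₁ (X * (A ⊗ₖ (1 : Matrix (Fin m) (Fin m) ℂ))) := by
  ext k l
  simp only [partialTrace₁, of_apply, mul_apply, Fintype.sum_prod_type, kroneckerMap_apply,
    one_apply, ite_mul, mul_ite, mul_one, zero_mul, mul_zero,
    Finset.sum_ite_eq, Finset.sum_ite_eq', Finset.mem_univ, if_true]
  rw [Finset.sum_comm]
  simp only [mul_comm]

theorem partialTrace₂_kronecker_one_mul (A : Matrix (Fin n) (Fin n) ℂ) :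
    partialTrace₂ ((A ⊗ₖ (1 : Matrix (Fin m) (Fin m) ℂ)) * X) = A * partialTrace₂ X := by
  ext k l
  simp only [partialTrace₂, of_apply, mul_apply, Fintype.sum_prod_type, kroneckerMap_apply,
    one_apply, ite_mul, mul_ite, mul_one, zero_mul, mul_zero, Finset.sum_ite_eq,
    Finset.mem_univ, if_true, Finset.mul_sum]
  exact Finset.sum_comm

theorem partialTrace₂_mul_kronecker_one (A : Matrix (Fin n) (Fin n) ℂ) :
    partialTrace₂ (X * (A ⊗ₖ (1 : Matrix (Fin m) (Fin m) ℂ))) = partialTrace₂ X * A := by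
  ext k l
  simp only [partialTrace₂, of_apply, mul_apply, Fintype.sum_prod_type, kroneckerMap_apply,
    one_apply, mul_ite, mul_one, mul_zero, Finset.sum_ite_eq',
    Finset.mem_univ, if_true, Finset.sum_mul]
  exact Finset.sum_comm

theorem partialTrace₂_one_kronecker_mul_comm (B : Matrix (Fin m) (Fin m) ℂ) :
    partialTrace₂ (((1 : Matrix (Fin n) (Fin n) ℂ) ⊗ₖ B) * X) =
      partialTrace₂ (X * ((1 : Matrix (Fin n) (Fin n) ℂ) ⊗ₖ B)) := by
  ext k l
  simp only [partialTrace₂, of_apply, mul_apply, Fintype.sum_prod_type, kroneckerMap_apply,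
    one_apply, ite_mul, mul_ite, one_mul, zero_mul, mul_zero, Finset.sum_ite_irrel,
    Finset.sum_const_zero, Finset.sum_ite_eq, Finset.sum_ite_eq', Finset.mem_univ, if_true]
  rw [Finset.sum_comm]
  simp only [mul_comm]

end PartialTrace

/-- The action `X ↦ (A* ⊗ B*) X (A ⊗ B)` of a pair of local operators. -/
def localConj {n m : ℕ} (A : Matrix (Fin n) (Fin n) ℂ) (B : Matrix (Fin m) (Fin m) ℂ)
    (X : Matrix (Fin n × Fin m) (Fin n × Fin m) ℂ) :
    Matrix (Fin n × Fin m) (Fin n × Fin m) ℂ :=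
  (Aᴴ ⊗ₖ Bᴴ) * X * (A ⊗ₖ B)

/-! ### The local action and its effect on marginals -/

section LocalConj

variable {n m : ℕ} (A A' : Matrix (Fin n) (Fin n) ℂ) (B B' : Matrix (Fin m) (Fin m) ℂ)
  (X : Matrix (Fin n × Fin m) (Fin n × Fin m) ℂ)

theorem localConj_eq : localConj A B X = (A ⊗ₖ B)ᴴ * X * (A ⊗ₖ B) := by
  rw [localConj, conjTranspose_kronecker]

theorem localConj_localConj :
    localConj A' B' (localConj A B X) = localConj (A * A') (B * B') X := by
  simp only [localConj_eq, mul_kronecker_mul, conjTranspose_mul, Matrix.mul_assoc]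

@[simp]
theorem localConj_one : localConj 1 1 X = X := by
  simp [localConj]

variable {A B} in
theorem partialTrace₁_localConj (hA : A ∈ unitaryGroup (Fin n) ℂ) :
    partialTrace₁ (localConj A B X) = Bᴴ * partialTrace₁ X * B := by
  have h : A * Aᴴ = 1 := mem_unitaryGroup_iff.mp hA
  have e : localConj A B X = ((1 : Matrix (Fin n) (Fin n) ℂ) ⊗ₖ Bᴴ) *
      ((Aᴴ ⊗ₖ (1 : Matrix (Fin m) (Fin m) ℂ)) * (X * (A ⊗ₖ (1 : Matrix (Fin m) (Fin m) ℂ)))) *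
      ((1 : Matrix (Fin n) (Fin n) ℂ) ⊗ₖ B) := by
    have h1 : A ⊗ₖ B = (A ⊗ₖ 1) * ((1 : Matrix (Fin n) (Fin n) ℂ) ⊗ₖ B) := by
      rw [← mul_kronecker_mul, one_mul, mul_one]
    have h2 : Aᴴ ⊗ₖ Bᴴ = ((1 : Matrix (Fin n) (Fin n) ℂ) ⊗ₖ Bᴴ) * (Aᴴ ⊗ₖ 1) := by
      rw [← mul_kronecker_mul, one_mul, mul_one]
    rw [localConj, h1, h2]
    simp only [Matrix.mul_assoc]
  rw [e, partialTrace₁_mul_one_kronecker, partialTrace₁_one_kronecker_mul,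
    partialTrace₁_kronecker_one_mul_comm, Matrix.mul_assoc X, ← mul_kronecker_mul, h, one_mul,
    one_kronecker_one, mul_one]

variable {A B} in
theorem partialTrace₂_localConj (hB : B ∈ unitaryGroup (Fin m) ℂ) :
    partialTrace₂ (localConj A B X) = Aᴴ * partialTrace₂ X * A := by
  have h : B * Bᴴ = 1 := mem_unitaryGroup_iff.mp hB
  have e : localConj A B X = (Aᴴ ⊗ₖ (1 : Matrix (Fin m) (Fin m) ℂ)) *
      (((1 : Matrix (Fin n) (Fin n) ℂ) ⊗ₖ Bᴴ) * (X * ((1 : Matrix (Fin n) (Fin n) ℂ) ⊗ₖ B))) *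
      (A ⊗ₖ (1 : Matrix (Fin m) (Fin m) ℂ)) := by
    have h1 : A ⊗ₖ B = ((1 : Matrix (Fin n) (Fin n) ℂ) ⊗ₖ B) * (A ⊗ₖ 1) := by
      rw [← mul_kronecker_mul, one_mul, mul_one]
    have h2 : Aᴴ ⊗ₖ Bᴴ = (Aᴴ ⊗ₖ 1) * ((1 : Matrix (Fin n) (Fin n) ℂ) ⊗ₖ Bᴴ) := by
      rw [← mul_kronecker_mul, one_mul, mul_one]
    rw [localConj, h1, h2]
    simp only [Matrix.mul_assoc]
  rw [e, partialTrace₂_mul_kronecker_one, partialTrace₂_kronecker_one_mul,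
    partialTrace₂_one_kronecker_mul_comm, Matrix.mul_assoc X, ← mul_kronecker_mul, h, one_mul,
    one_kronecker_one, mul_one]

variable {A B X} in
theorem posDef_localConj (hX : X.PosDef) (hA : IsUnit A) (hB : IsUnit B) :
    (localConj A B X).PosDef := by
  rw [localConj_eq]
  refine hX.conjTranspose_mul_mul_same (B := A ⊗ₖ B) ?_
  have : IsUnit (A ⊗ₖ B) := by
    rw [isUnit_iff_isUnit_det, det_kronecker]
    exact (((isUnit_iff_isUnit_det _).1 hA).pow _).mul (((isUnit_iff_isUnit_det _).1 hB).pow _)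
  exact mulVec_injective_of_isUnit this

end LocalConj

theorem IsState.posDef {ι : Type*} [Fintype ι] [DecidableEq ι] {ρ : Matrix ι ι ℂ}
    (h : IsState ρ) : ρ.PosDef :=
  h.1.posDef_iff_isUnit.2 h.2.1

/-- Over an empty index set the trace would be 0, not 1. -/
theorem State.pos {n m : ℕ} (ρ : State n m) : 0 < n ∧ 0 < m := by
  have h := ρ.2.2.2
  constructor
  · rcases Nat.eq_zero_or_pos n with rfl | hn
    · simp [trace] at h
    · exact hn
  · rcases Nat.eq_zero_or_pos m with rfl | hm
    · simp [trace] at h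
    · exact hm

/-- A Hermitian matrix with positive diagonal whose trace is minimal on its orbit under
`S ↦ A* S A`, `det A = 1`, is scalar. -/
theorem eq_smul_one_of_trace_minimal {ι : Type*} [Fintype ι] [DecidableEq ι] {S : Matrix ι ι ℂ}
    (hS : S.IsHermitian) (hpos : ∀ i, 0 < S i i)
    (hmin : ∀ A : Matrix ι ι ℂ, A.det = 1 → S.trace.re ≤ (Aᴴ * S * A).trace.re) :
    ∃ s : ℂ, S = s • 1 := by
  have hoff : ∀ i j, i ≠ j → S i j = 0 := by
    intro i j hij
    by_contra hne
    set a : ℝ := (S i i).re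
    have ha : 0 < a := (Complex.pos_iff.1 (hpos i)).1
    have hherm : S j i = star (S i j) := (hS.apply j i).symm
    -- Test minimality on `1 + c E_ij`: the change of trace is quadratic in `c`, and its linear part
    -- sees `S i j`.
    have key : ∀ c : ℂ, 0 ≤ (c * S j i + star c * S i j + c * star c * S i i).re := by
      intro c
      have := hmin (transvection i j c) (det_transvection_of_ne i j hij c)
      have e : ((transvection i j c)ᴴ * S * transvection i j c).trace =
          S.trace + (c * S j i + star c * S i j + c * star c * S i i) := by
        simp only [transvection, conjTranspose_add, conjTranspose_one, conjTranspose_single,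
          add_mul, mul_add, one_mul, mul_one, trace_add]
        rw [Matrix.mul_assoc]
        simp only [trace_single_mul, trace_mul_single, RCLike.star_def]
        simp
        ring
      rw [e, Complex.add_re] at this
      linarith
    have hns : 0 < Complex.normSq (S i j) := Complex.normSq_pos.2 hne
    -- With `t = 1 / (a + 1)` and `c = -t * S i j` the change is `|S i j|² t (t a - 2)`, negative
    -- since `t a < 1`.
    have h := key (-((1 / (a + 1) : ℝ) : ℂ) * S i j)
    have e : (-((1 / (a + 1) : ℝ) : ℂ) * S i j * S j i +
        star (-((1 / (a + 1) : ℝ) : ℂ) * S i j) * S i j + -((1 / (a + 1) : ℝ) : ℂ) * S i j *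
        star (-((1 / (a + 1) : ℝ) : ℂ) * S i j) * S i i).re =
        Complex.normSq (S i j) * (1 / (a + 1)) * (1 / (a + 1) * a - 2) := by
      have hi : S i i = (a : ℂ) :=
        Complex.ext rfl (Complex.pos_iff.1 (hpos i)).2.symm
      rw [hherm, hi, ← Complex.ofReal_re (Complex.normSq (S i j) * _ * _)]
      congr 1
      have := Complex.mul_conj (S i j)
      simp only [star_mul', star_neg, RCLike.star_def, Complex.conj_ofReal, Complex.ofReal_mul,
        ← this]
      push_cast
      ring
    rw [e] at h
    have h1 : 1 / (a + 1) * a < 1 := by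
      rw [one_div_mul_eq_div, div_lt_one (by linarith)]
      linarith
    have h2 : 0 < Complex.normSq (S i j) * (1 / (a + 1)) := by positivity
    nlinarith
  have hdiag : ∀ i j, S i i = S j j := by
    intro i j
    rcases eq_or_ne i j with rfl | hij
    · rfl
    obtain ⟨hi, hi'⟩ := Complex.pos_iff.1 (hpos i)
    obtain ⟨hj, hj'⟩ := Complex.pos_iff.1 (hpos j)
    refine Complex.ext ?_ (hi'.symm.trans hj')
    set a := (S i i).re
    set b := (S j j).re
    have hα := Real.sqrt_pos.2 hi
    have hβ := Real.sqrt_pos.2 hj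
    have hα2 := Real.sq_sqrt hi.le
    have hβ2 := Real.sq_sqrt hj.le
    set α := √a
    set β := √b
    -- Scaling coordinates `i`, `j` by `t`, `t⁻¹` replaces `a + b` by `t² a + t⁻² b`. This `t`
    -- attains the AM-GM minimum `2αβ`, so `(α - β)² ≤ 0`.
    set t := √(β / α)
    have ht : 0 < t := Real.sqrt_pos.2 (div_pos hβ hα)
    have ht2 : t ^ 2 = β / α := Real.sq_sqrt (div_pos hβ hα).le
    let d : ι → ℝ := fun k => (if k = i then t else 1) * (if k = j then t⁻¹ else 1)
    have hd : (diagonal fun k => (d k : ℂ)).det = 1 := by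
      rw [det_diagonal, ← Complex.ofReal_prod, Finset.prod_mul_distrib, Finset.prod_ite_eq',
        Finset.prod_ite_eq', if_pos (Finset.mem_univ _), if_pos (Finset.mem_univ _),
        mul_inv_cancel₀ ht.ne', Complex.ofReal_one]
    have h := hmin _ hd
    have e : (((diagonal fun k => (d k : ℂ))ᴴ * S * diagonal fun k => (d k : ℂ)).trace).re =
        S.trace.re + (t ^ 2 - 1) * a + ((t⁻¹) ^ 2 - 1) * b := by
      have e1 : ∀ k, (((d k : ℂ) * S k k * (d k : ℂ))).re = (S k k).re +
          (if k = i then (t ^ 2 - 1) * (S k k).re else 0) +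
          (if k = j then ((t⁻¹) ^ 2 - 1) * (S k k).re else 0) := by
        intro k
        have : ((d k : ℂ) * S k k * (d k : ℂ)).re = d k ^ 2 * (S k k).re := by
          simp; ring
        rw [this]
        by_cases h1 : k = i
        · have h2 : k ≠ j := h1 ▸ hij
          simp only [d, h1, if_true, if_neg hij]; ring
        · by_cases h2 : k = j
          · simp only [d, h2, if_true, if_neg hij.symm]; ring
          · simp [d, h1, h2]
      simp only [trace, diag_apply, diagonal_conjTranspose, mul_diagonal, diagonal_mul,
        Complex.re_sum, Pi.star_apply, RCLike.star_def, Complex.conj_ofReal]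
      rw [Finset.sum_congr rfl fun k _ => e1 k]
      simp [Finset.sum_add_distrib, a, b]
    rw [e, inv_pow, ht2] at h
    have h1 : β / α * a = α * β := by rw [← hα2]; field_simp
    have h2 : (β / α)⁻¹ * b = α * β := by rw [← hβ2]; field_simp
    have h3 : (α - β) ^ 2 ≤ 0 := by nlinarith
    have h4 : α = β := by
      have := pow_eq_zero_iff (two_ne_zero) |>.1 (le_antisymm h3 (sq_nonneg _))
      linarith
    rw [← hα2, ← hβ2, h4]
  rcases isEmpty_or_nonempty ι with h | ⟨⟨i₀⟩⟩
  · exact ⟨0, Subsingleton.elim _ _⟩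
  · refine ⟨S i₀ i₀, ?_⟩
    ext i j
    rcases eq_or_ne i j with rfl | hij
    · simp [hdiag i i₀]
    · simp [hoff i j hij, hij]

/-! ### Existence: compactness, the minimiser and its normalisation -/

section Existence

open scoped MatrixOrder in
/-- Coercivity of `M ↦ tr (M* ρ M)` for positive definite `ρ`. -/
theorem exists_norm_apply_sq_le_trace {ι : Type*} [Fintype ι] [DecidableEq ι] {ρ : Matrix ι ι ℂ}
    (hρ : ρ.PosDef) :
    ∃ K : ℝ, 0 ≤ K ∧ ∀ (M : Matrix ι ι ℂ) (i j : ι), ‖M i j‖ ^ 2 ≤ K * (Mᴴ * ρ * M).trace.re := by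
  -- Writing `ρ = N* N` turns the trace into the squared Frobenius norm of `N M`; then `M = N⁻¹ (N
  -- M)` is bounded entrywise.
  obtain ⟨N, hN, rfl⟩ :=
    CStarAlgebra.isStrictlyPositive_iff_eq_star_mul_self.mp hρ.isStrictlyPositive
  have hdet := (isUnit_iff_isUnit_det N).1 hN
  set k : ℝ := ∑ i, ∑ j, ‖N⁻¹ i j‖
  have hk : 0 ≤ k := by positivity
  refine ⟨k ^ 2, by positivity, fun M i j => ?_⟩
  have htr : (Mᴴ * (star N * N) * M).trace.re = ∑ l, ∑ p, ‖(N * M) p l‖ ^ 2 := by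
    have : Mᴴ * (star N * N) * M = (N * M)ᴴ * (N * M) := by
      rw [conjTranspose_mul, star_eq_conjTranspose]
      simp only [Matrix.mul_assoc]
    rw [this]
    simp only [trace, diag_apply, Complex.re_sum]
    refine Finset.sum_congr rfl fun l _ => ?_
    rw [mul_apply, Complex.re_sum]
    refine Finset.sum_congr rfl fun p _ => ?_
    rw [conjTranspose_apply, RCLike.star_def, Complex.conj_mul', ← Complex.ofReal_pow,
      Complex.ofReal_re]
  rw [htr]
  set f : ℝ := ∑ l, ∑ p, ‖(N * M) p l‖ ^ 2
  have hf : 0 ≤ f := by positivity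
  have hle : ∀ p, ‖(N * M) p j‖ ≤ √f := fun p => by
    refine Real.le_sqrt_of_sq_le ?_
    calc ‖(N * M) p j‖ ^ 2 ≤ ∑ p, ‖(N * M) p j‖ ^ 2 :=
          Finset.single_le_sum (f := fun p => ‖(N * M) p j‖ ^ 2) (fun _ _ => by positivity)
            (Finset.mem_univ p)
      _ ≤ f := Finset.single_le_sum (f := fun l => ∑ p, ‖(N * M) p l‖ ^ 2)
            (fun _ _ => by positivity) (Finset.mem_univ j)
  have hM : M i j = ∑ p, N⁻¹ i p * (N * M) p j := by
    rw [← mul_apply, nonsing_inv_mul_cancel_left _ _ hdet]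
  have hn : ‖M i j‖ ≤ k * √f := by
    rw [hM]
    calc ‖∑ p, N⁻¹ i p * (N * M) p j‖ ≤ ∑ p, ‖N⁻¹ i p * (N * M) p j‖ := norm_sum_le _ _
      _ ≤ ∑ p, ‖N⁻¹ i p‖ * √f := Finset.sum_le_sum fun p _ => by
          rw [norm_mul]; exact mul_le_mul_of_nonneg_left (hle p) (norm_nonneg _)
      _ = (∑ p, ‖N⁻¹ i p‖) * √f := by rw [Finset.sum_mul]
      _ ≤ k * √f := mul_le_mul_of_nonneg_right
          (Finset.single_le_sum (f := fun i => ∑ j, ‖N⁻¹ i j‖) (fun _ _ => by positivity)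
            (Finset.mem_univ i)) (Real.sqrt_nonneg _)
  calc ‖M i j‖ ^ 2 ≤ (k * √f) ^ 2 := by gcongr
    _ = k ^ 2 * f := by rw [mul_pow, Real.sq_sqrt hf]

/-- Matrices of determinant one have an entry that is bounded away from zero. -/
theorem exists_le_norm_apply_of_det_eq_one (n : ℕ) (hn : 0 < n) :
    ∃ δ : ℝ, 0 < δ ∧ ∀ A : Matrix (Fin n) (Fin n) ℂ, A.det = 1 → ∃ i j, δ ≤ ‖A i j‖ := by
  have hF : (0 : ℝ) < n.factorial := by exact_mod_cast n.factorial_pos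
  -- If all entries were below `δ`, the Leibniz formula would give `|det A| ≤ n! δ ^ n ≤ n! δ < 1`;
  -- `δ ^ n ≤ δ` needs `n ≠ 0`.
  refine ⟨1 / (n.factorial + 1), by positivity, fun A hA => ?_⟩
  by_contra! h
  have h1 := det_le (A := A) (abv := NormedField.toAbsoluteValue ℂ)
    (x := 1 / ((n.factorial : ℝ) + 1)) fun i j => (h i j).le
  rw [hA, map_one, Fintype.card_fin, nsmul_eq_mul] at h1
  have h2 : (1 / ((n.factorial : ℝ) + 1)) ^ n ≤ 1 / ((n.factorial : ℝ) + 1) :=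
    pow_le_of_le_one (by positivity) ((div_le_one (by positivity)).2 (by linarith)) hn.ne'
  have h3 : (n.factorial : ℝ) * (1 / ((n.factorial : ℝ) + 1)) < 1 := by
    rw [mul_one_div, div_lt_one (by positivity)]
    linarith
  have := mul_le_mul_of_nonneg_left h2 hF.le
  linarith

theorem isCompact_setOf_norm_apply_le (n : ℕ) (C : ℝ) :
    IsCompact {A : Matrix (Fin n) (Fin n) ℂ | ∀ i j, ‖A i j‖ ≤ C} := by
  have h := isCompact_univ_pi (X := fun _ : Fin n => Fin n → ℂ)
    (s := fun _ => Set.univ.pi fun _ => Metric.closedBall (0 : ℂ) C)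
    fun _ => isCompact_univ_pi fun _ => isCompact_closedBall 0 C
  refine h.of_isClosed_subset ?_ fun A hA i _ j _ => mem_closedBall_zero_iff.2 (hA i j)
  simp only [Set.ofPred_forall]
  exact isClosed_iInter fun i => isClosed_iInter fun j =>
    isClosed_le (continuous_id.matrix_elem i j).norm continuous_const

variable {n m : ℕ}

/-- Coercivity bounds the products `‖A i j‖ * ‖B k l‖` on a sublevel set. Each factor has an entry
bounded below, so the other factor is bounded and the sublevel set is compact. -/
theorem exists_trace_localConj_minimal (hn : 0 < n) (hm : 0 < m)
    {ρ : Matrix (Fin n × Fin m) (Fin n × Fin m) ℂ} (hρ : ρ.PosDef) :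
    ∃ (A : Matrix (Fin n) (Fin n) ℂ) (B : Matrix (Fin m) (Fin m) ℂ), A.det = 1 ∧ B.det = 1 ∧
      ∀ (A' : Matrix (Fin n) (Fin n) ℂ) (B' : Matrix (Fin m) (Fin m) ℂ), A'.det = 1 → B'.det = 1 →
        (localConj A B ρ).trace.re ≤ (localConj A' B' ρ).trace.re := by
  obtain ⟨K, hK0, hK⟩ := exists_norm_apply_sq_le_trace hρ
  obtain ⟨δ, hδ, hA⟩ := exists_le_norm_apply_of_det_eq_one n hn
  obtain ⟨ε, hε, hB⟩ := exists_le_norm_apply_of_det_eq_one m hm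
  set f : Matrix (Fin n) (Fin n) ℂ × Matrix (Fin m) (Fin m) ℂ → ℝ :=
    fun p => (localConj p.1 p.2 ρ).trace.re with hf
  have hcont : Continuous f := by
    have h1 : Continuous fun p : Matrix (Fin n) (Fin n) ℂ × Matrix (Fin m) (Fin m) ℂ =>
        p.1 ⊗ₖ p.2 := by
      refine continuous_matrix fun i j => ?_
      simp only [kroneckerMap_apply]
      exact (continuous_fst.matrix_elem _ _).mul (continuous_snd.matrix_elem _ _)
    simp only [hf, localConj_eq]
    exact Complex.continuous_re.comp
      (((h1.matrix_conjTranspose.matrix_mul continuous_const).matrix_mul h1).matrix_trace)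
  set R := √(K * f (1, 1))
  set S : Set (Matrix (Fin n) (Fin n) ℂ × Matrix (Fin m) (Fin m) ℂ) :=
    {p | p.1.det = 1 ∧ p.2.det = 1 ∧ f p ≤ f (1, 1)} with hS
  have hclosed : IsClosed S :=
    (isClosed_eq continuous_fst.matrix_det continuous_const).inter
      ((isClosed_eq continuous_snd.matrix_det continuous_const).inter
        (isClosed_le hcont continuous_const))
  have hsub : S ⊆ {A : Matrix (Fin n) (Fin n) ℂ | ∀ i j, ‖A i j‖ ≤ R / ε} ×ˢ
      {B : Matrix (Fin m) (Fin m) ℂ | ∀ i j, ‖B i j‖ ≤ R / δ} := by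
    rintro ⟨A, B⟩ ⟨h1, h2, h3⟩
    have hAB : ∀ i j k l, ‖A i j‖ * ‖B k l‖ ≤ R := by
      intro i j k l
      refine Real.le_sqrt_of_sq_le ?_
      have := hK (A ⊗ₖ B) (i, k) (j, l)
      rw [← localConj_eq, kroneckerMap_apply, norm_mul] at this
      exact this.trans (mul_le_mul_of_nonneg_left h3 hK0)
    obtain ⟨a, b, hab⟩ := hA A h1
    obtain ⟨c, d, hcd⟩ := hB B h2
    refine ⟨fun i j => ?_, fun k l => ?_⟩
    · rw [le_div_iff₀ hε]
      exact (mul_le_mul_of_nonneg_left hcd (norm_nonneg _)).trans (hAB i j c d)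
    · rw [le_div_iff₀ hδ, mul_comm]
      exact (mul_le_mul_of_nonneg_right hab (norm_nonneg _)).trans (hAB a b k l)
  have hcomp : IsCompact S :=
    ((isCompact_setOf_norm_apply_le n _).prod (isCompact_setOf_norm_apply_le m _)).of_isClosed_subset
      hclosed hsub
  obtain ⟨⟨A, B⟩, ⟨h1, h2, h3⟩, hmin⟩ := hcomp.exists_isMinOn
    ⟨(1, 1), det_one, det_one, le_rfl⟩ hcont.continuousOn
  refine ⟨A, B, h1, h2, fun A' B' hA' hB' => ?_⟩
  rcases le_total (f (A', B')) (f (1, 1)) with h | h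
  · exact isMinOn_iff.1 hmin (A', B') ⟨hA', hB', h⟩
  · exact h3.trans h

theorem isHermitian_partialTrace₁ {X : Matrix (Fin n × Fin m) (Fin n × Fin m) ℂ}
    (hX : X.IsHermitian) : (partialTrace₁ X).IsHermitian := by
  ext i j
  simp only [conjTranspose_apply, partialTrace₁, of_apply, star_sum, hX.apply]

theorem partialTrace₁_apply_self_pos (hn : 0 < n)
    {X : Matrix (Fin n × Fin m) (Fin n × Fin m) ℂ} (hX : X.PosDef) (i : Fin m) :
    0 < partialTrace₁ X i i :=
  Finset.sum_pos (fun j _ => hX.diag_pos (i := (j, i))) ⟨⟨0, hn⟩, Finset.mem_univ _⟩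

theorem isHermitian_partialTrace₂ {X : Matrix (Fin n × Fin m) (Fin n × Fin m) ℂ}
    (hX : X.IsHermitian) : (partialTrace₂ X).IsHermitian := by
  ext i j
  simp only [conjTranspose_apply, partialTrace₂, of_apply, star_sum, hX.apply]

theorem partialTrace₂_apply_self_pos (hm : 0 < m)
    {X : Matrix (Fin n × Fin m) (Fin n × Fin m) ℂ} (hX : X.PosDef) (i : Fin n) :
    0 < partialTrace₂ X i i :=
  Finset.sum_pos (fun j _ => hX.diag_pos (i := (i, j))) ⟨⟨0, hm⟩, Finset.mem_univ _⟩

theorem exists_precopula_connected (ρ : State n m) : ∃ χ : Precopula n m, Connected ρ χ.1 := by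
  obtain ⟨hn, hm⟩ := ρ.pos
  have : Nonempty (Fin n × Fin m) := ⟨(⟨0, hn⟩, ⟨0, hm⟩)⟩
  obtain ⟨A, B, hA, hB, hmin⟩ := exists_trace_localConj_minimal hn hm ρ.2.posDef
  have hAu : IsUnit A := (isUnit_iff_isUnit_det A).2 (hA ▸ isUnit_one)
  have hBu : IsUnit B := (isUnit_iff_isUnit_det B).2 (hB ▸ isUnit_one)
  have hσ := posDef_localConj ρ.2.posDef hAu hBu
  set σ := localConj A B ρ.1 with hσdef
  -- Determinant-one matrices are closed under products, so the minimum may be recentred at the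
  -- identity.
  have hσmin : ∀ (A' : Matrix (Fin n) (Fin n) ℂ) (B' : Matrix (Fin m) (Fin m) ℂ), A'.det = 1 →
      B'.det = 1 → σ.trace.re ≤ (localConj A' B' σ).trace.re := by
    intro A' B' hA' hB'
    rw [hσdef, localConj_localConj]
    exact hmin _ _ (by rw [det_mul, hA, hA', one_mul]) (by rw [det_mul, hB, hB', one_mul])
  obtain ⟨s₁, hs₁⟩ := eq_smul_one_of_trace_minimal
      (isHermitian_partialTrace₁ hσ.isHermitian) (partialTrace₁_apply_self_pos hn hσ) fun B' hB' => by
    have := hσmin 1 B' det_one hB'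
    rwa [← trace_partialTrace₁, ← trace_partialTrace₁ (localConj _ _ _),
      partialTrace₁_localConj _ (one_mem _)] at this
  obtain ⟨s₂, hs₂⟩ := eq_smul_one_of_trace_minimal
      (isHermitian_partialTrace₂ hσ.isHermitian) (partialTrace₂_apply_self_pos hm hσ) fun A' hA' => by
    have := hσmin A' 1 hA' det_one
    rwa [← trace_partialTrace₂, ← trace_partialTrace₂ (localConj _ _ _),
      partialTrace₂_localConj _ (one_mem _)] at this
  obtain ⟨hτ, hτ'⟩ := Complex.pos_iff.1 hσ.trace_pos
  set τ := σ.trace.re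
  have hτe : σ.trace = (τ : ℂ) := Complex.ext rfl hτ'.symm
  have hτ0 : (τ : ℂ) ≠ 0 := Complex.ofReal_ne_zero.2 hτ.ne'
  have hm0 : (m : ℂ) ≠ 0 := Nat.cast_ne_zero.2 hm.ne'
  have hn0 : (n : ℂ) ≠ 0 := Nat.cast_ne_zero.2 hn.ne'
  have ht₁ : s₁ * m = τ := by
    rw [← hτe, ← trace_partialTrace₁, hs₁, trace_smul, trace_one, Fintype.card_fin, smul_eq_mul]
  have ht₂ : s₂ * n = τ := by
    rw [← hτe, ← trace_partialTrace₂, hs₂, trace_smul, trace_one, Fintype.card_fin, smul_eq_mul]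
  -- The factor `τ⁻¹` is absorbed into `A`, which occurs twice, hence the square root.
  set r : ℝ := √τ⁻¹
  have hr : 0 < r := Real.sqrt_pos.2 (inv_pos.2 hτ)
  have hrr : (r : ℂ) * r = (τ : ℂ)⁻¹ := by
    rw [← Complex.ofReal_mul, Real.mul_self_sqrt (inv_pos.2 hτ).le, Complex.ofReal_inv]
  have hr0 : (r : ℂ) ≠ 0 := Complex.ofReal_ne_zero.2 hr.ne'
  have hχe : localConj ((r : ℂ) • A) B ρ.1 = (τ : ℂ)⁻¹ • σ := by
    rw [← hrr, hσdef, localConj, localConj, conjTranspose_smul, smul_kronecker, smul_kronecker,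
      Matrix.mul_smul, Matrix.smul_mul, Matrix.smul_mul, smul_smul, RCLike.star_def,
      Complex.conj_ofReal]
  have hrA : IsUnit ((r : ℂ) • A) := by
    rw [isUnit_iff_isUnit_det, det_smul, hA, mul_one]
    exact (isUnit_iff_ne_zero.2 hr0).pow _
  have hχ : ((τ : ℂ)⁻¹ • σ).PosDef := hχe ▸ posDef_localConj ρ.2.posDef hrA hBu
  refine ⟨⟨⟨(τ : ℂ)⁻¹ • σ, hχ.posSemidef, hχ.isUnit, ?_⟩, ?_, ?_⟩, (r : ℂ) • A, B, hrA, hBu,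
    hχe.symm⟩
  · rw [trace_smul, hτe, smul_eq_mul, inv_mul_cancel₀ hτ0]
  · change partialTrace₁ ((τ : ℂ)⁻¹ • σ) = _
    rw [partialTrace₁_smul, hs₁, smul_smul, ← ht₁]
    congr 1
    have : s₁ ≠ 0 := left_ne_zero_of_mul (ht₁ ▸ hτ0)
    field_simp
  · change partialTrace₂ ((τ : ℂ)⁻¹ • σ) = _
    rw [partialTrace₂_smul, hs₂, smul_smul, ← ht₂]
    congr 1
    have : s₂ ≠ 0 := left_ne_zero_of_mul (ht₂ ▸ hτ0)
    field_simp

end Existence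

/-! ### Uniqueness: reduction to positive diagonal matrices -/

section Uniqueness

/-- Singular value decomposition of an invertible matrix. -/
theorem exists_unitary_mul_diagonal_mul_unitary {ι : Type*} [Fintype ι] [DecidableEq ι]
    {A : Matrix ι ι ℂ} (hA : IsUnit A) :
    ∃ U ∈ unitaryGroup ι ℂ, ∃ W ∈ unitaryGroup ι ℂ, ∃ d : ι → ℝ, (∀ i, 0 < d i) ∧
      A = U * diagonal (fun i => (d i : ℂ)) * W := by
  have hP : (A * Aᴴ).PosDef := by
    have := (PosDef.one (n := ι) (R := ℂ)).mul_mul_conjTranspose_same (B := A)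
      (vecMul_injective_of_isUnit hA)
    simpa using this
  set U := (hP.1.eigenvectorUnitary : Matrix ι ι ℂ)
  have hUm : U ∈ unitaryGroup ι ℂ := hP.1.eigenvectorUnitary.2
  have hUU : U * Uᴴ = 1 := mem_unitaryGroup_iff.mp hUm
  have hUU' : Uᴴ * U = 1 := mem_unitaryGroup_iff'.mp hUm
  set e : ι → ℝ := hP.1.eigenvalues
  have he : ∀ i, 0 < e i := hP.eigenvalues_pos
  have hspec : A * Aᴴ = U * diagonal (fun i => (e i : ℂ)) * Uᴴ := by
    have := hP.1.spectral_theorem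
    rw [Unitary.conjStarAlgAut_apply] at this
    exact this
  let d : ι → ℝ := fun i => √(e i)
  have hd : ∀ i, 0 < d i := fun i => Real.sqrt_pos.2 (he i)
  have hdc : ∀ i, (d i : ℂ) ≠ 0 := fun i => Complex.ofReal_ne_zero.2 (hd i).ne'
  have hde : ∀ i, (e i : ℂ) = d i * d i := fun i => by
    rw [← Complex.ofReal_mul, Real.mul_self_sqrt (he i).le]
  set D : Matrix ι ι ℂ := diagonal fun i => (d i : ℂ)
  set D' : Matrix ι ι ℂ := diagonal fun i => (d i : ℂ)⁻¹
  have hDD' : D * D' = 1 := by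
    simp [D, D', hdc]
  have hD'H : D'ᴴ = D' := by
    simp only [D', diagonal_conjTranspose]
    congr 1
    ext i
    simp
  have hDD : D' * diagonal (fun i => (e i : ℂ)) * D' = 1 := by
    simp only [D', diagonal_mul_diagonal, hde, ← diagonal_one]
    congr 1
    ext i
    have := hdc i
    field_simp
  -- Here `D = √(U* A A* U)` and `D' = D⁻¹`, so `D' U* A` is the unitary polar factor of `U* A`.
  refine ⟨U, hUm, D' * Uᴴ * A, ?_, d, hd, ?_⟩
  · rw [mem_unitaryGroup_iff, star_eq_conjTranspose]
    simp only [conjTranspose_mul, conjTranspose_conjTranspose, hD'H]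
    calc D' * Uᴴ * A * (Aᴴ * (U * D')) = D' * Uᴴ * (A * Aᴴ) * U * D' := by
          simp only [Matrix.mul_assoc]
      _ = D' * (Uᴴ * U) * diagonal (fun i => (e i : ℂ)) * (Uᴴ * U) * D' := by
          rw [hspec]; simp only [Matrix.mul_assoc]
      _ = 1 := by rw [hUU', mul_one, mul_one, hDD]
  · calc A = U * (D * D') * Uᴴ * A := by rw [hDD', mul_one, hUU, one_mul]
      _ = U * D * (D' * Uᴴ * A) := by simp only [Matrix.mul_assoc]

variable {n m : ℕ}

/-- Uniform marginals are preserved by local unitaries. -/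
theorem partialTraces_localConj_eq_smul_one {X : Matrix (Fin n × Fin m) (Fin n × Fin m) ℂ}
    {a b : ℂ} (h₁ : partialTrace₁ X = a • 1) (h₂ : partialTrace₂ X = b • 1)
    {U : Matrix (Fin n) (Fin n) ℂ} (hU : U ∈ unitaryGroup (Fin n) ℂ)
    {V : Matrix (Fin m) (Fin m) ℂ} (hV : V ∈ unitaryGroup (Fin m) ℂ) :
    partialTrace₁ (localConj U V X) = a • 1 ∧ partialTrace₂ (localConj U V X) = b • 1 := by
  have hU' : Uᴴ * U = 1 := mem_unitaryGroup_iff'.mp hU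
  have hV' : Vᴴ * V = 1 := mem_unitaryGroup_iff'.mp hV
  constructor
  · rw [partialTrace₁_localConj _ hU, h₁, Matrix.mul_smul, Matrix.smul_mul, mul_one, hV']
  · rw [partialTrace₂_localConj _ hV, h₂, Matrix.mul_smul, Matrix.smul_mul, mul_one, hU']

theorem sub_one_mul_log_pos {x : ℝ} (hx : 0 < x) (h1 : x ≠ 1) : 0 < (x - 1) * Real.log x := by
  rcases lt_or_gt_of_ne h1 with h | h
  · exact mul_pos_of_neg_of_neg (by linarith) (Real.log_neg hx h)
  · exact mul_pos (by linarith) (Real.log_pos h)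

/-- A positive array is determined by its marginals and its class modulo rescaling of rows and
columns. -/
theorem mul_eq_one_of_marginals_eq {p : Fin n → Fin m → ℝ} (hp : ∀ i k, 0 < p i k)
    {x : Fin n → ℝ} {y : Fin m → ℝ} (hx : ∀ i, 0 < x i) (hy : ∀ k, 0 < y k)
    (hrow : ∀ i, ∑ k, p i k * (x i * y k) = ∑ k, p i k)
    (hcol : ∀ k, ∑ i, p i k * (x i * y k) = ∑ i, p i k) (i : Fin n) (k : Fin m) :
    x i * y k = 1 := by
  have hterm : ∀ i k, 0 ≤ p i k * ((x i * y k - 1) * Real.log (x i * y k)) := by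
    intro i k
    rcases eq_or_ne (x i * y k) 1 with h | h
    · simp [h]
    · exact (mul_pos (hp i k) (sub_one_mul_log_pos (mul_pos (hx i) (hy k)) h)).le
  -- For `q = p x y` this is the symmetrised relative entropy `∑ (q - p) log (q / p)`. The logarithm
  -- splits into a row part and a column part, each killed by equality of marginals.
  have hsum : ∑ i, ∑ k, p i k * ((x i * y k - 1) * Real.log (x i * y k)) = 0 := by
    have h1 : ∀ i, ∑ k, (p i k * (x i * y k) - p i k) * Real.log (x i) = 0 := fun i => by
      rw [← Finset.sum_mul, Finset.sum_sub_distrib, hrow, sub_self, zero_mul]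
    have h2 : ∀ k, ∑ i, (p i k * (x i * y k) - p i k) * Real.log (y k) = 0 := fun k => by
      rw [← Finset.sum_mul, Finset.sum_sub_distrib, hcol, sub_self, zero_mul]
    have h3 : ∀ i k, p i k * ((x i * y k - 1) * Real.log (x i * y k)) =
        (p i k * (x i * y k) - p i k) * Real.log (x i) +
        (p i k * (x i * y k) - p i k) * Real.log (y k) := fun i k => by
      rw [Real.log_mul (hx i).ne' (hy k).ne']; ring
    simp only [h3, Finset.sum_add_distrib, h1, zero_add]
    rw [Finset.sum_comm]
    simp only [h2, Finset.sum_const_zero]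
  by_contra h
  have h0 := (Finset.sum_eq_zero_iff_of_nonneg fun i _ =>
    Finset.sum_nonneg fun k _ => hterm i k).1 hsum i (Finset.mem_univ i)
  have h1 := (Finset.sum_eq_zero_iff_of_nonneg fun k _ => hterm i k).1 h0 k (Finset.mem_univ k)
  exact (mul_pos (hp i k) (sub_one_mul_log_pos (mul_pos (hx i) (hy k)) h)).ne' h1

/-- Only the diagonal of `X` is needed to get `d i * e k = 1`; every entry of `X` is rescaled by two
such products, so all of `X` is fixed. -/
theorem localConj_diagonal_eq_self {X : Matrix (Fin n × Fin m) (Fin n × Fin m) ℂ} (hX : X.PosDef)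
    {d : Fin n → ℝ} {e : Fin m → ℝ} (hd : ∀ i, 0 < d i) (he : ∀ k, 0 < e k)
    (h₁ : partialTrace₁ (localConj (diagonal fun i => (d i : ℂ)) (diagonal fun k => (e k : ℂ)) X) =
      partialTrace₁ X)
    (h₂ : partialTrace₂ (localConj (diagonal fun i => (d i : ℂ)) (diagonal fun k => (e k : ℂ)) X) =
      partialTrace₂ X) :
    localConj (diagonal fun i => (d i : ℂ)) (diagonal fun k => (e k : ℂ)) X = X := by
  have happ : ∀ a b, localConj (diagonal fun i => (d i : ℂ)) (diagonal fun k => (e k : ℂ)) X a b =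
      ((d a.1 * e a.2 : ℝ) : ℂ) * X a b * ((d b.1 * e b.2 : ℝ) : ℂ) := by
    intro a b
    rw [localConj_eq, diagonal_kronecker_diagonal, diagonal_conjTranspose, mul_diagonal,
      diagonal_mul]
    simp
  have hre : ∀ i k, (((d i * e k : ℝ) : ℂ) * X (i, k) (i, k) * ((d i * e k : ℝ) : ℂ)).re =
      (X (i, k) (i, k)).re * (d i ^ 2 * e k ^ 2) := by
    intro i k
    rw [Complex.re_mul_ofReal, Complex.re_ofReal_mul]
    ring
  have key := mul_eq_one_of_marginals_eq (p := fun i k => (X (i, k) (i, k)).re)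
    (fun i k => (Complex.pos_iff.1 hX.diag_pos).1) (x := fun i => d i ^ 2) (y := fun k => e k ^ 2)
    (fun i => pow_pos (hd i) 2) (fun k => pow_pos (he k) 2)
    (fun i => by
      have := congrArg Complex.re (congrFun (congrFun h₂ i) i)
      simpa only [partialTrace₂, of_apply, Complex.re_sum, happ, hre] using this)
    (fun k => by
      have := congrArg Complex.re (congrFun (congrFun h₁ k) k)
      simpa only [partialTrace₁, of_apply, Complex.re_sum, happ, hre] using this)
  have hone : ∀ i k, d i * e k = 1 := fun i k => by
    have := key i k
    rw [← mul_pow] at this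
    exact (pow_eq_one_iff_of_nonneg (mul_pos (hd i) (he k)).le two_ne_zero).1 this
  ext a b
  rw [happ, hone, hone]
  simp

theorem localUnitaryEquiv_of_connected {χ χ' : Precopula n m} (h : Connected χ.1 χ'.1) :
    LocalUnitaryEquiv χ χ' := by
  obtain ⟨A, B, hA, hB, hAB⟩ := h
  obtain ⟨U, hU, W, hW, d, hd, rfl⟩ := exists_unitary_mul_diagonal_mul_unitary hA
  obtain ⟨V, hV, Z, hZ, e, he, rfl⟩ := exists_unitary_mul_diagonal_mul_unitary hB
  change χ'.1.1 = localConj _ _ _ at hAB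
  rw [← localConj_localConj, ← localConj_localConj] at hAB
  have hW' : W * Wᴴ = 1 := mem_unitaryGroup_iff.mp hW
  have hZ' : Z * Zᴴ = 1 := mem_unitaryGroup_iff.mp hZ
  have hX : (localConj U V χ.1.1).PosDef := posDef_localConj χ.1.2.posDef
    (IsUnit.of_mul_eq_one _ (mem_unitaryGroup_iff.mp hU))
    (IsUnit.of_mul_eq_one _ (mem_unitaryGroup_iff.mp hV))
  obtain ⟨h₁, h₂⟩ := partialTraces_localConj_eq_smul_one χ.2.1 χ.2.2 hU hV
  obtain ⟨h₁', h₂'⟩ := partialTraces_localConj_eq_smul_one χ'.2.1 χ'.2.2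
    (U := Wᴴ) (Unitary.star_mem hW) (V := Zᴴ) (Unitary.star_mem hZ)
  set X := localConj U V χ.1.1
  -- Undoing `W` and `Z` on `χ'` keeps its marginals uniform, so the diagonal action on `X`
  -- preserves marginals.
  have hback : localConj Wᴴ Zᴴ χ'.1.1 =
      localConj (diagonal fun i => (d i : ℂ)) (diagonal fun k => (e k : ℂ)) X := by
    rw [hAB, localConj_localConj, hW', hZ', localConj_one]
  rw [hback] at h₁' h₂'
  rw [localConj_diagonal_eq_self hX hd he (h₁'.trans h₁.symm) (h₂'.trans h₂.symm),
    localConj_localConj] at hAB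
  exact ⟨U * W, mul_mem hU hW, V * Z, mul_mem hV hZ, hAB⟩

end Uniqueness

/-! ### Connectedness as an equivalence relation, and the conclusion -/

theorem Connected.symm {n m : ℕ} {ρ ρ' : State n m} (h : Connected ρ ρ') : Connected ρ' ρ := by
  obtain ⟨A, B, hA, hB, h⟩ := h
  have hA' := mul_nonsing_inv A ((isUnit_iff_isUnit_det A).1 hA)
  have hB' := mul_nonsing_inv B ((isUnit_iff_isUnit_det B).1 hB)
  refine ⟨A⁻¹, B⁻¹, isUnit_nonsing_inv_iff.2 hA, isUnit_nonsing_inv_iff.2 hB, ?_⟩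
  change ρ'.1 = localConj A B ρ.1 at h
  change ρ.1 = localConj _ _ _
  rw [h, localConj_localConj, hA', hB', localConj_one]

theorem Connected.trans {n m : ℕ} {ρ ρ' ρ'' : State n m} (h : Connected ρ ρ')
    (h' : Connected ρ' ρ'') : Connected ρ ρ'' := by
  obtain ⟨A, B, hA, hB, h⟩ := h
  obtain ⟨A', B', hA', hB', h'⟩ := h'
  change ρ'.1 = localConj A B ρ.1 at h
  change ρ''.1 = localConj A' B' ρ'.1 at h'
  refine ⟨A * A', B * B', hA.mul hA', hB.mul hB', ?_⟩
  change ρ''.1 = localConj _ _ _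
  rw [h', h, localConj_localConj]

theorem LocalUnitaryEquiv.connected {n m : ℕ} {χ χ' : Precopula n m}
    (h : LocalUnitaryEquiv χ χ') : Connected χ.1 χ'.1 := by
  obtain ⟨U, hU, V, hV, h⟩ := h
  exact ⟨U, V, IsUnit.of_mul_eq_one _ (mem_unitaryGroup_iff.mp hU),
    IsUnit.of_mul_eq_one _ (mem_unitaryGroup_iff.mp hV), h⟩

end QuantumCopula

theorem mainTheorem1 (n m : ℕ) (ρ : QuantumCopula.State n m) :
    ∃! c : QuantumCopula.Copula n m,
      ∀ χ : QuantumCopula.Precopula n m,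
        (Quotient.mk (QuantumCopula.precopulaSetoid n m) χ = c) →
          QuantumCopula.Connected ρ χ.1 := by
  obtain ⟨χ₀, h₀⟩ := QuantumCopula.exists_precopula_connected ρ
  refine ⟨Quotient.mk _ χ₀, fun χ hχ => ?_, fun c hc => ?_⟩
  · have h : QuantumCopula.LocalUnitaryEquiv χ χ₀ := Quotient.exact hχ
    exact h₀.trans h.connected.symm
  · obtain ⟨χ, rfl⟩ := Quotient.exists_rep c
    exact Quotient.sound (QuantumCopula.localUnitaryEquiv_of_connected ((hc χ rfl).symm.trans h₀))
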